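/- Model. There are two states of nature $\omega\in\{0,1\}$ and two firms $0,1$; in state $\omega$ the product of firm $\omega$ is the superior one (value $1$) and the other is inferior (value $0$). The state is drawn once, with $P(\omega=0)=\mu_0=1-P(\omega=1)$, $\mu_0\in(0,1)$. In each period $t=1,2,\dots$ the two firms, who observe only the public history $h_t\in([0,1]^2\times\{0,1,e\})^{t-1}$ of past prices and actions, post (possibly random, independently drawn) prices $(\tau_0,\tau_1)\in[0,1]^2$. Consumer $t$ then observes $h_t$, the prices, and a private signal in a measurable space $S$, and chooses $a\in\{0,1,e\}$ (buy from firm $0$, buy from firm $1$, or exit), possibly at random. Conditional on $\omega$, signals are i.i.d. with law $F_\omega$, where $F_0$ and $F_1$ are mutually absolutely continuous probability measures. The consumer's utility is $0$ if $a=e$, $1-\tau_a$ if $a=\omega$, and $-\tau_a$ if $a\in\{0,1\}$, $a\ne\omega$; the stage payoff of firm $i$ is $\tau_i$ if $a=i$ and $0$ otherwise. A profile of (measurable) strategies $(\bar\phi_0,\bar\phi_1,\bar\sigma)$ induces a probability measure $\mathbf P$ on states, prices, signals and actions; let $\mu_t=\mathbf P(\omega=0\mid h_t)$. The profile is a myopic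 Bayesian Nash equilibrium if for every $t$ and $\mathbf P$-almost every $h_t$: (i) no firm $i$ can increase its expected stage payoff conditional on $h_t$ by replacing $\bar\phi_i(h_t)$ by a price $\tau\in[0,1]$, the other firm's strategy and the consumer's decision rule being fixed; and (ii) for every price vector $(\tau_0,\tau_1)\in[0,1]^2$ the decision rule $\bar\sigma(h_t)$ maximizes consumer $t$'s expected utility conditional on $h_t$ among all decision rules (measurable maps from prices and signals to lotteries over actions). Learning holds for $\mu_0$ and the profile if, $\mathbf P$-almost surely, $\mu_t\to 1$ when $\omega=0$ and $\mu_t\to 0$ when $\omega=1$. Corollary. Let $(\bar\phi_0,\bar\phi_1,\bar\sigma)$ be a myopic Bayesian Nash equilibrium for the prior $\mu_0\in(0,1)$, and suppose that learning holds for $\mu_0$ and this equilibrium (in particular, this is the case if asymptotic learning holds for the signal structure $(F_0,F_1,S)$, that is, if learning holds for every prior in $(0,1)$ and every corresponding myopic Bayesian Nash equilibrium). Then for each state $\omega\in\{0,1\}$, $$\lim_{t\to\infty}\mathbf P\bigl(\text{consumer } t \text{ buys from firm } \omega \,\bigm|\, \text{the state is } \omega\bigr)=1 .$$ -/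

import Mathlib

open MeasureTheory ProbabilityTheory Filter Topology

namespace DuopolyLearning

/-- The states of nature, which are also the names of the two firms: in state `ω` firm `ω` produces
the superior product. -/
abbrev State := Fin 2

/-- The actions of a consumer: `some i` is to buy from firm `i`, `none` is to exit. -/
abbrev Action := Option (Fin 2)

instance : MeasurableSpace Action := ⊤

instance : DiscreteMeasurableSpace Action := ⟨fun _ => MeasurableSpace.measurableSet_top⟩

/-- Price vectors `(τ₀, τ₁) ∈ [0,1]²`. -/
abbrev Prices := unitInterval × unitInterval

/-- The price asked by firm `i`. -/
def Prices.of (τ : Prices) (i : Fin 2) : ℝ := if i = 0 then (τ.1 : ℝ) else (τ.2 : ℝ)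

/-- The payoff of the consumer who takes action `a` at prices `τ` in state `ω`: the superior product
has value `1`, the inferior one has value `0`. -/
def utility (a : Action) (τ : Prices) (ω : State) : ℝ :=
  match a with
  | none => 0
  | some i => if i = ω then 1 - τ.of i else - τ.of i

/-- The stage payoff of firm `i` (there are no costs of production). -/
def profit (i : Fin 2) (a : Action) (τ : Prices) : ℝ := if a = some i then τ.of i else 0

/-- Public histories at the start of the period with index `t = 0, 1, 2, …`: the prices and the
actions of the `t` periods before it. -/
abbrev History (t : ℕ) := Fin t → Prices × Action

/-- All that happens in one period: the prices, the private signal of the consumer and the action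
of the consumer. -/
abbrev Period (S : Type*) := (Prices × S) × Action

/-- A signal structure on the measurable space `S`: a pair of mutually absolutely continuous
probability measures. -/
structure SignalStructure (S : Type*) [MeasurableSpace S] where
  /-- the law of the signal conditional on the state -/
  F : State → Measure S
  isProbabilityMeasure : ∀ ω, IsProbabilityMeasure (F ω)
  absolutelyContinuous : ∀ ω ω', F ω ≪ F ω'

attribute [instance] SignalStructure.isProbabilityMeasure

/-- A strategy profile. In each period, the firms choose (possibly random) prices as functions of the
public history, independently of each other; the decision rule of the consumer, which may depend on
the public history, assigns a (possibly degenerate) lottery over actions to each pair of a price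
vector and a signal. -/
structure StrategyProfile (S : Type*) [MeasurableSpace S] where
  firm : Fin 2 → (t : ℕ) → Kernel (History t) unitInterval
  consumer : (t : ℕ) → Kernel (History t × (Prices × S)) Action
  isMarkovKernel_firm : ∀ i t, IsMarkovKernel (firm i t)
  isMarkovKernel_consumer : ∀ t, IsMarkovKernel (consumer t)

attribute [instance] StrategyProfile.isMarkovKernel_firm StrategyProfile.isMarkovKernel_consumer

noncomputable section

variable {S : Type*} [MeasurableSpace S]

/-- The prior on the states, with `P(ω = 0) = μ₀ = 1 - P(ω = 1)`. -/
def prior (μ₀ : ℝ) : Measure State :=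
  ENNReal.ofReal μ₀ • Measure.dirac 0 + ENNReal.ofReal (1 - μ₀) • Measure.dirac 1

instance (μ₀ : ℝ) : IsFiniteMeasure (prior μ₀) := by
  refine ⟨?_⟩
  simp [prior]

/-- The law of what happens in the period with index `t`, given the state and the public history:
the firms draw their prices, the consumer gets a signal with law `F ω`, and then acts. -/
def periodKernel (G : SignalStructure S) (π : StrategyProfile S) (ω : State) (t : ℕ) :
    Kernel (History t) (Period S) :=
  ((π.firm 0 t ×ₖ π.firm 1 t) ×ₖ Kernel.const (History t) (G.F ω)) ⊗ₖ π.consumer t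

instance (G : SignalStructure S) (π : StrategyProfile S) (ω : State) (t : ℕ) :
    IsMarkovKernel (periodKernel G π ω t) := by
  unfold periodKernel
  infer_instance

/-- The public history contained in the periods with indices `0, …, t`. -/
def pastHistory (t : ℕ) (x : (i : Finset.Iic t) → Period S) : History (t + 1) := fun k =>
  let p := x ⟨k, Finset.mem_Iic.2 (Nat.lt_succ_iff.1 k.isLt)⟩
  (p.1.1, p.2)

lemma measurable_pastHistory (t : ℕ) : Measurable (pastHistory (S := S) t) := by
  unfold pastHistory
  fun_prop

/-- The law of the whole sequence of periods, given the state. -/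
def pathLaw (G : SignalStructure S) (π : StrategyProfile S) (ω : State) :
    Measure (ℕ → Period S) :=
  Kernel.trajMeasure (X := fun _ => Period S) (periodKernel G π ω 0 Fin.elim0)
    (fun t => (periodKernel G π ω (t + 1)).comap (pastHistory t) (measurable_pastHistory t))

instance (G : SignalStructure S) (π : StrategyProfile S) (ω : State) :
    IsProbabilityMeasure (pathLaw G π ω) := by
  unfold pathLaw
  infer_instance

/-- The space of outcomes: the state, and the prices, signals and actions of all periods. -/
abbrev Outcome (S : Type*) := State × (ℕ → Period S)

/-- The probability distribution on outcomes that the prior, the signal structure and the strategy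
profile induce. -/
def outcomeLaw (μ₀ : ℝ) (G : SignalStructure S) (π : StrategyProfile S) : Measure (Outcome S) :=
  prior μ₀ ⊗ₘ Kernel.ofFunOfCountable (pathLaw G π)

instance (G : SignalStructure S) (π : StrategyProfile S) :
    IsMarkovKernel (Kernel.ofFunOfCountable (pathLaw G π)) :=
  ⟨fun ω => inferInstanceAs (IsProbabilityMeasure (pathLaw G π ω))⟩

instance (μ₀ : ℝ) (G : SignalStructure S) (π : StrategyProfile S) :
    IsFiniteMeasure (outcomeLaw μ₀ G π) := by
  unfold outcomeLaw
  infer_instance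

/-- The realized state. -/
def state (x : Outcome S) : State := x.1

/-- The realized public history at the start of the period with index `t`. -/
def history (t : ℕ) (x : Outcome S) : History t := fun k => ((x.2 k).1.1, (x.2 k).2)

/-- The realized action of the consumer of the period with index `t`. -/
def action (t : ℕ) (x : Outcome S) : Action := (x.2 t).2

/-- The conditional distribution of the state given the public history (a regular version). -/
def posterior (μ₀ : ℝ) (G : SignalStructure S) (π : StrategyProfile S) (t : ℕ) :
    Kernel (History t) State :=
  condDistrib state (history t) (outcomeLaw μ₀ G π)

/-- The public belief `P(ω = 0 | h)` after the public history `h`. -/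
def publicBelief (μ₀ : ℝ) (G : SignalStructure S) (π : StrategyProfile S) (t : ℕ)
    (h : History t) : ℝ :=
  (posterior μ₀ G π t h).real {0}

/-- The expectation of a payoff `u` that depends on the state and on the action of the consumer, when
the state has law `ν`, the posted prices are `τ`, and the consumer uses the decision rule `σ`. -/
def expectedPayoff (G : SignalStructure S) (ν : Measure State) (σ : Kernel (Prices × S) Action)
    (τ : Prices) (u : State → Action → ℝ) : ℝ :=
  ∫ ω, ∫ s, ∫ a, u ω a ∂(σ (τ, s)) ∂(G.F ω) ∂ν

/-- The expected utility of the consumer at the posted prices `τ`. -/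
def consumerUtility (G : SignalStructure S) (ν : Measure State) (τ : Prices)
    (σ : Kernel (Prices × S) Action) : ℝ :=
  expectedPayoff G ν σ τ fun ω a => utility a τ ω

/-- The expected stage payoff of firm `i` when the firms use the mixed prices `φ 0` and `φ 1`. -/
def firmProfit (G : SignalStructure S) (ν : Measure State) (i : Fin 2)
    (φ : Fin 2 → Measure unitInterval) (σ : Kernel (Prices × S) Action) : ℝ :=
  ∫ τ, expectedPayoff G ν σ τ (fun _ a => profit i a τ) ∂((φ 0).prod (φ 1))

/-- The mixed prices that the profile prescribes after the history `h`. -/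
def StrategyProfile.pricesAt (π : StrategyProfile S) {t : ℕ} (h : History t) :
    Fin 2 → Measure unitInterval :=
  fun i => π.firm i t h

/-- The decision rule that the profile prescribes after the history `h`. -/
def StrategyProfile.ruleAt (π : StrategyProfile S) {t : ℕ} (h : History t) :
    Kernel (Prices × S) Action :=
  (π.consumer t).sectR h

/-- Myopic Bayesian Nash equilibrium: in every period, after almost every public history, no firm can
raise its expected stage payoff by another price, and at every price vector (on or off the path) the
decision rule of the consumer is optimal among all decision rules. -/
def IsMyopicEquilibrium (μ₀ : ℝ) (G : SignalStructure S) (π : StrategyProfile S) : Prop :=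
  ∀ t : ℕ, ∀ᵐ h ∂((outcomeLaw μ₀ G π).map (history t)),
    (∀ (i : Fin 2) (p : unitInterval),
      firmProfit G (posterior μ₀ G π t h) i
          (Function.update (π.pricesAt h) i (Measure.dirac p)) (π.ruleAt h) ≤
        firmProfit G (posterior μ₀ G π t h) i (π.pricesAt h) (π.ruleAt h)) ∧
    (∀ (τ : Prices) (σ : Kernel (Prices × S) Action), IsMarkovKernel σ →
      consumerUtility G (posterior μ₀ G π t h) τ σ ≤
        consumerUtility G (posterior μ₀ G π t h) τ (π.ruleAt h))

/-- Learning holds for `μ₀` and the profile: almost surely the public belief converges to the point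
belief on the realized state. -/
def LearningHolds (μ₀ : ℝ) (G : SignalStructure S) (π : StrategyProfile S) : Prop :=
  ∀ᵐ x ∂(outcomeLaw μ₀ G π),
    Tendsto (fun t => publicBelief μ₀ G π t (history t x)) atTop
      (𝓝 (if state x = 0 then 1 else 0))

end

end DuopolyLearning

/-!
The profit of the firm with the superior product forces the result. Suppose that after a public
history the belief that firm `i` is superior is at least `1 - ε`. Against any price of the
competitor, a consumer who always buys from firm `i` at the price `p` gets at least `1 - ε - p`; an
optimal decision rule does no worse, and a rule under which firm `i` sells with probability `Q` gets
at most `(1 - p) * Q + ε`. Hence `Q ≥ 1 - 2 * ε / (1 - p)` (`le_demand_of_optimal`), and firm `i` can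
secure the profit `p * (1 - 2 * ε / (1 - p))` (`le_firmProfit_update`), which is close to `1` for
suitable `p` when `ε` is small. In equilibrium its profit is no smaller, and since prices are at most
`1`, the profit is at most the probability of a sale (`firmProfit_le`). So after almost every history
with such a belief the consumer buys from firm `i` with probability close to `1`.

To pass from histories to the whole outcome space, `outcomeLaw_history_action` computes the
probability of a history event followed by an action from the posterior and the period kernels.
Learning means that the belief in the realized state converges to `1` almost surely, hence in
probability (`LearningHolds.tendsto_measure`), so that histories with a low belief in the realized
state contribute a vanishing probability.
-/

namespace DuopolyLearning

noncomputable section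

variable {S : Type*} [MeasurableSpace S]

/-! ### The law of a period given the public history -/

/-- The public history of the first `t` periods of a path. -/
def pathHistory (t : ℕ) (p : ℕ → Period S) : History t := fun k => ((p k).1.1, (p k).2)

@[fun_prop]
lemma measurable_pathHistory (t : ℕ) : Measurable (pathHistory (S := S) t) := by
  unfold pathHistory
  fun_prop

lemma pathLaw_map_zero (G : SignalStructure S) (π : StrategyProfile S) (ω : State) :
    (pathLaw G π ω).map (fun p => p 0) = periodKernel G π ω 0 Fin.elim0 := by
  have h : (fun p : ℕ → Period S => p 0) =
      (MeasurableEquiv.piUnique (fun _ : Finset.Iic 0 => Period S)) ∘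
        (Preorder.frestrictLe (π := fun _ => Period S) 0) := rfl
  rw [h, ← Measure.map_map (by fun_prop) (by fun_prop), pathLaw, Kernel.trajMeasure,
    Measure.map_comp _ _ (by fun_prop), Kernel.traj_map_frestrictLe, Kernel.partialTraj_self,
    Measure.id_comp, Measure.map_map (by fun_prop) (by fun_prop)]
  convert Measure.map_id
  exact MeasurableEquiv.self_comp_symm _

/-- Given the state and the public history of the first `t` periods, period `t` has the law
`periodKernel`. -/
lemma pathLaw_map_history_period (G : SignalStructure S) (π : StrategyProfile S) (ω : State)
    (t : ℕ) :
    (pathLaw G π ω).map (fun p => (pathHistory t p, p t)) =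
      ((pathLaw G π ω).map (pathHistory t)) ⊗ₘ periodKernel G π ω t := by
  have : IsProbabilityMeasure ((pathLaw G π ω).map (pathHistory t)) :=
    Measure.isProbabilityMeasure_map (by fun_prop)
  ext s hs
  rw [Measure.compProd_apply hs]
  cases t with
  | zero =>
    have hm : (fun p : ℕ → Period S => (pathHistory 0 p, p 0)) =
        (fun y => ((Fin.elim0 : History 0), y)) ∘ fun p => p 0 := by
      ext1 p
      exact Prod.ext (Subsingleton.elim _ _) rfl
    have hc (h : History 0) : periodKernel G π ω 0 h (Prod.mk h ⁻¹' s) =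
        periodKernel G π ω 0 Fin.elim0 (Prod.mk Fin.elim0 ⁻¹' s) := by
      rw [Subsingleton.elim h Fin.elim0]
    simp_rw [hc]
    rw [hm, ← Measure.map_map (by fun_prop) (by fun_prop), pathLaw_map_zero,
      Measure.map_apply (by fun_prop) hs]
    simp
  | succ t =>
    have hm : (fun p : ℕ → Period S => (pathHistory (t + 1) p, p (t + 1))) =
        Prod.map (pastHistory t) id ∘
          fun p => (Preorder.frestrictLe (π := fun _ => Period S) t p, p (t + 1)) := rfl
    have hh : pathHistory (S := S) (t + 1) =
        pastHistory t ∘ Preorder.frestrictLe (π := fun _ => Period S) t := rfl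
    have hp := measurable_pastHistory (S := S) t
    rw [hm, hh, ← Measure.map_map (by fun_prop) (by fun_prop),
      ← Measure.map_map (by fun_prop) (by fun_prop), Measure.map_apply (by fun_prop) hs,
      lintegral_map (Kernel.measurable_kernel_prodMk_left hs) hp, pathLaw,
      ← Kernel.map_frestrictLe_trajMeasure_compProd_eq_map_trajMeasure,
      Measure.compProd_apply ((by fun_prop : Measurable (Prod.map (pastHistory t) id)) hs)]
    rfl

@[fun_prop]
lemma measurable_state : Measurable (state (S := S)) := measurable_fst

@[fun_prop]
lemma measurable_history (t : ℕ) : Measurable (history (S := S) t) := by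
  unfold history
  fun_prop

@[fun_prop]
lemma measurable_action (t : ℕ) : Measurable (action (S := S) t) := by
  unfold action
  fun_prop

/-- The posterior averages the conditional laws of a period given the state: this computes the
probability of a public history in `A` followed by action `a`. -/
lemma outcomeLaw_history_action (μ₀ : ℝ) (G : SignalStructure S) (π : StrategyProfile S) (t : ℕ)
    {A : Set (History t)} (hA : MeasurableSet A) (a : Action) :
    outcomeLaw μ₀ G π {x | history t x ∈ A ∧ action t x = a} =
      ∫⁻ h in A, ∫⁻ ω, periodKernel G π ω t h {y | y.2 = a} ∂(posterior μ₀ G π t h)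
        ∂((outcomeLaw μ₀ G π).map (history t)) := by
  have hB : MeasurableSet {y : Period S | y.2 = a} := measurable_snd (measurableSet_singleton a)
  have hf : Measurable fun z : History t × State =>
      A.indicator (fun h => periodKernel G π z.2 t h {y | y.2 = a}) z.1 :=
    measurable_from_prod_countable_left fun ω =>
      (Kernel.measurable_coe (periodKernel G π ω t) hB).indicator hA
  have hS : MeasurableSet {x : Outcome S | history t x ∈ A ∧ action t x = a} :=
    (measurable_history t hA).inter (measurable_action t (measurableSet_singleton a))
  have hg : Measurable fun x : Outcome S =>
      A.indicator (fun h => periodKernel G π (state x) t h {y | y.2 = a}) (history t x) :=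
    hf.comp ((measurable_history t).prodMk measurable_state)
  calc outcomeLaw μ₀ G π {x | history t x ∈ A ∧ action t x = a}
      = ∫⁻ x, A.indicator (fun h => periodKernel G π (state x) t h {y | y.2 = a}) (history t x)
          ∂(outcomeLaw μ₀ G π) := by
        rw [outcomeLaw, Measure.compProd_apply hS, Measure.lintegral_compProd hg]
        refine lintegral_congr fun ω => ?_
        change pathLaw G π ω ((fun p => (pathHistory t p, p t)) ⁻¹'
            (A ×ˢ {y : Period S | y.2 = a})) =
          ∫⁻ p, A.indicator (fun h => periodKernel G π ω t h {y | y.2 = a}) (pathHistory t p)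
            ∂(pathLaw G π ω)
        rw [← Measure.map_apply (by fun_prop) (hA.prod hB), pathLaw_map_history_period,
          Measure.compProd_apply_prod hA hB, ← lintegral_indicator hA,
          lintegral_map ((Kernel.measurable_coe _ hB).indicator hA) (by fun_prop)]
    _ = ∫⁻ z, A.indicator (fun h => periodKernel G π z.2 t h {y | y.2 = a}) z.1
          ∂((outcomeLaw μ₀ G π).map (history t) ⊗ₘ posterior μ₀ G π t) := by
        rw [posterior, compProd_map_condDistrib (by fun_prop),
          lintegral_map hf (by fun_prop)]
    _ = _ := by
        have : IsMarkovKernel (posterior μ₀ G π t) := by unfold posterior; infer_instance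
        rw [Measure.lintegral_compProd hf, ← lintegral_indicator hA]
        refine lintegral_congr fun h => ?_
        by_cases hh : h ∈ A <;> simp [hh]

/-! ### Demand and profits in the stage game -/

/-- The probability that a consumer with decision rule `σ` takes action `a` at prices `τ`, given the
state `ω`. -/
def demand (G : SignalStructure S) (σ : Kernel (Prices × S) Action) (a : Action) (ω : State)
    (τ : Prices) : ℝ :=
  ∫ s, (σ (τ, s)).real {a} ∂(G.F ω)

section Demand

variable (G : SignalStructure S) (σ : Kernel (Prices × S) Action)

lemma demand_nonneg (a : Action) (ω : State) (τ : Prices) : 0 ≤ demand G σ a ω τ :=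
  integral_nonneg fun _ => measureReal_nonneg

lemma measurable_real_singleton (a : Action) : Measurable fun z => (σ z).real {a} :=
  (Kernel.measurable_coe σ (measurableSet_singleton a)).ennreal_toReal

lemma stronglyMeasurable_demand (a : Action) (ω : State) :
    StronglyMeasurable (demand G σ a ω) :=
  (measurable_real_singleton σ a).stronglyMeasurable.integral_prod_right

variable [IsMarkovKernel σ]

lemma integrable_real_singleton (a : Action) (ω : State) (τ : Prices) :
    Integrable (fun s => (σ (τ, s)).real {a}) (G.F ω) := by
  refine .of_bound ((measurable_real_singleton σ a).comp measurable_prodMk_left).aestronglyMeasurable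
    1 (ae_of_all _ fun s => ?_)
  rw [Real.norm_of_nonneg measureReal_nonneg]
  exact measureReal_le_one

lemma sum_demand (ω : State) (τ : Prices) : ∑ a, demand G σ a ω τ = 1 := by
  unfold demand
  rw [← integral_finsetSum _ fun a _ => integrable_real_singleton G σ a ω τ]
  simp [sum_measureReal_singleton]

lemma demand_le_one (a : Action) (ω : State) (τ : Prices) : demand G σ a ω τ ≤ 1 := by
  rw [← sum_demand G σ ω τ]
  exact Finset.single_le_sum (fun b _ => demand_nonneg G σ b ω τ) (Finset.mem_univ a)

lemma integrable_demand (a : Action) (ω : State) (m : Measure Prices) [IsFiniteMeasure m] :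
    Integrable (demand G σ a ω) m := by
  refine .of_bound (stronglyMeasurable_demand G σ a ω).aestronglyMeasurable 1
    (ae_of_all _ fun τ => ?_)
  rw [Real.norm_of_nonneg (demand_nonneg G σ a ω τ)]
  exact demand_le_one G σ a ω τ

lemma expectedPayoff_eq_sum (ν : Measure State) [IsFiniteMeasure ν] (τ : Prices)
    (u : State → Action → ℝ) :
    expectedPayoff G ν σ τ u = ∑ ω, ν.real {ω} * ∑ a, demand G σ a ω τ * u ω a := by
  unfold expectedPayoff demand
  rw [integral_fintype .of_finite]
  refine Finset.sum_congr rfl fun ω _ => ?_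
  simp_rw [smul_eq_mul, integral_fintype (Integrable.of_finite (μ := σ _)), smul_eq_mul]
  rw [integral_finsetSum _ fun a _ => (integrable_real_singleton G σ a ω τ).mul_const _]
  simp_rw [integral_mul_const]

lemma expectedPayoff_profit (ν : Measure State) [IsFiniteMeasure ν] (τ : Prices) (i : Fin 2) :
    expectedPayoff G ν σ τ (fun _ a => profit i a τ) =
      τ.of i * ∑ ω, ν.real {ω} * demand G σ (some i) ω τ := by
  rw [expectedPayoff_eq_sum, Finset.mul_sum]
  refine Finset.sum_congr rfl fun ω _ => ?_
  simp only [profit, mul_ite, mul_zero, Finset.sum_ite_eq', Finset.mem_univ, if_true]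
  ring

end Demand

lemma Prices.of_nonneg (τ : Prices) (i : Fin 2) : 0 ≤ τ.of i := by
  unfold Prices.of
  split_ifs
  exacts [τ.1.2.1, τ.2.2.1]

lemma Prices.of_le_one (τ : Prices) (i : Fin 2) : τ.of i ≤ 1 := by
  unfold Prices.of
  split_ifs
  exacts [τ.1.2.2, τ.2.2.2]

lemma Prices.measurable_of (i : Fin 2) : Measurable fun τ : Prices => τ.of i := by
  unfold Prices.of
  split_ifs <;> fun_prop

lemma sum_real_singleton_state (ν : Measure State) [IsProbabilityMeasure ν] :
    ∑ ω, ν.real {ω} = 1 := by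
  simp [sum_measureReal_singleton]

/-- Comparison with the rule that always buys from firm `i`: under an optimal rule, firm `i` fails to
sell with probability at most `2 * ε / (1 - τ.of i)` if its product is inferior with
probability `ε`, whatever the price of its competitor. -/
lemma le_demand_of_optimal (G : SignalStructure S) (ν : Measure State) [IsProbabilityMeasure ν]
    (σ : Kernel (Prices × S) Action) [IsMarkovKernel σ] (τ : Prices)
    (hσ : ∀ σ' : Kernel (Prices × S) Action, IsMarkovKernel σ' →
      consumerUtility G ν τ σ' ≤ consumerUtility G ν τ σ) (i : Fin 2) :
    (1 - τ.of i) - 2 * (1 - ν.real {i}) ≤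
      (1 - τ.of i) * ∑ ω, ν.real {ω} * demand G σ (some i) ω τ := by
  have h := hσ (Kernel.const _ (Measure.dirac (some i))) inferInstance
  have hd (a : Action) (ω : State) : demand G
      (Kernel.const (Prices × S) (Measure.dirac (some i : Action))) a ω τ =
        if a = some i then 1 else 0 := by
    by_cases ha : a = some i
    · simp [demand, ha, measureReal_def]
    · simp [demand, ha, measureReal_def, Ne.symm ha]
  have hs0 := sum_demand G σ 0 τ
  have hs1 := sum_demand G σ 1 τ
  have hν := sum_real_singleton_state ν
  have hn (a : Action) (ω : State) := demand_nonneg G σ a ω τ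
  have hν0 : 0 ≤ ν.real {0} := measureReal_nonneg
  have hν1 : 0 ≤ ν.real {1} := measureReal_nonneg
  simp only [consumerUtility, expectedPayoff_eq_sum, hd] at h
  simp only [utility, Fintype.sum_option, Fin.sum_univ_two] at h hs0 hs1 hν ⊢
  have hντ (j : Fin 2) : (ν.real {0} + ν.real {1}) * τ.of j = τ.of j := by rw [hν, one_mul]
  have key (ω : State) (a : Action) (j : Fin 2) (hν' : 0 ≤ ν.real {ω}) :
      0 ≤ ν.real {ω} * (demand G σ a ω τ * τ.of j) :=
    mul_nonneg hν' (mul_nonneg (hn a ω) (τ.of_nonneg j))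
  have k2 (ω : State) (a : Action) (hν' : 0 ≤ ν.real {ω}) :
      0 ≤ ν.real {ω} * demand G σ a ω τ :=
    mul_nonneg hν' (hn a ω)
  have k3 (ω : State) (a : Action) (hν' : 0 ≤ ν.real {ω}) :
      ν.real {ω} * demand G σ a ω τ ≤ ν.real {ω} :=
    mul_le_of_le_one_right hν' (demand_le_one G σ a ω τ)
  fin_cases i
  · simp at h ⊢
    linarith [key 0 (some 1) 1 hν0, key 1 (some 1) 1 hν1, k2 1 (some 0) hν1,
      k3 1 (some 1) hν1, hντ 0]
  · simp at h ⊢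
    linarith [key 0 (some 0) 0 hν0, key 1 (some 0) 0 hν1, k2 0 (some 1) hν0,
      k3 0 (some 0) hν0, hντ 1]

lemma integrable_sum_demand (G : SignalStructure S) (ν : Measure State)
    (σ : Kernel (Prices × S) Action) [IsMarkovKernel σ] (i : Fin 2) (m : Measure Prices)
    [IsFiniteMeasure m] :
    Integrable (fun τ => ∑ ω, ν.real {ω} * demand G σ (some i) ω τ) m :=
  integrable_finsetSum _ fun ω _ => (integrable_demand G σ (some i) ω m).const_mul _

lemma integrable_mul_sum_demand (G : SignalStructure S) (ν : Measure State)
    (σ : Kernel (Prices × S) Action) [IsMarkovKernel σ] (i : Fin 2) (m : Measure Prices)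
    [IsFiniteMeasure m] :
    Integrable (fun τ : Prices => τ.of i * ∑ ω, ν.real {ω} * demand G σ (some i) ω τ) m := by
  refine (integrable_sum_demand G ν σ i m).bdd_mul (c := 1)
    (Prices.measurable_of i).aestronglyMeasurable (ae_of_all _ fun τ => ?_)
  rw [Real.norm_of_nonneg (τ.of_nonneg i)]
  exact τ.of_le_one i

/-- As prices are at most `1`, the profit of a firm is at most the probability that it sells. -/
lemma firmProfit_le (G : SignalStructure S) (ν : Measure State) [IsFiniteMeasure ν] (i : Fin 2)
    (φ : Fin 2 → Measure unitInterval) [∀ j, IsProbabilityMeasure (φ j)]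
    (σ : Kernel (Prices × S) Action) [IsMarkovKernel σ] :
    firmProfit G ν i φ σ ≤
      ∑ ω, ν.real {ω} * ∫ τ, demand G σ (some i) ω τ ∂((φ 0).prod (φ 1)) := by
  unfold firmProfit
  simp_rw [expectedPayoff_profit, ← integral_const_mul]
  rw [← integral_finsetSum _ fun ω _ => (integrable_demand G σ (some i) ω _).const_mul _]
  refine integral_mono (integrable_mul_sum_demand G ν σ i _) (integrable_sum_demand G ν σ i _)
    fun τ => mul_le_of_le_one_left ?_ (Prices.of_le_one τ i)
  exact Finset.sum_nonneg fun ω _ => mul_nonneg measureReal_nonneg (demand_nonneg G σ _ ω τ)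

/-- A lower bound for the profit of firm `i` from the sure price `p`, when the rule of the consumer is
optimal at all prices and firm `i` is the superior one with probability at least `1 - ε`. -/
lemma le_firmProfit_update (G : SignalStructure S) (ν : Measure State) [IsProbabilityMeasure ν]
    (i : Fin 2) (φ : Fin 2 → Measure unitInterval) [∀ j, IsProbabilityMeasure (φ j)]
    (σ : Kernel (Prices × S) Action) [IsMarkovKernel σ]
    (hσ : ∀ (τ : Prices) (σ' : Kernel (Prices × S) Action), IsMarkovKernel σ' →
      consumerUtility G ν τ σ' ≤ consumerUtility G ν τ σ)
    (p : unitInterval) (hp : (p : ℝ) < 1) {ε : ℝ} (hε : 1 - ε ≤ ν.real {i}) :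
    (p : ℝ) * (1 - 2 * ε / (1 - p)) ≤
      firmProfit G ν i (Function.update φ i (Measure.dirac p)) σ := by
  set ψ := Function.update φ i (Measure.dirac p) with hψ
  have hψp (j : Fin 2) : IsProbabilityMeasure (ψ j) := by
    by_cases h : j = i
    · subst h; simp only [hψ, Function.update_self]; infer_instance
    · simp only [hψ, Function.update_of_ne h]; infer_instance
  have hτ : ∀ᵐ τ ∂((ψ 0).prod (ψ 1)), Prices.of τ i = p := by
    have hi : ∀ᵐ q ∂(ψ i), q = p := by
      simp only [hψ, Function.update_self]
      exact ae_eq_dirac id |>.mono fun q hq => hq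
    fin_cases i
    · exact (Measure.quasiMeasurePreserving_fst.ae hi).mono fun τ h => by
        simpa [Prices.of] using congrArg Subtype.val h
    · exact (Measure.quasiMeasurePreserving_snd.ae hi).mono fun τ h => by
        simpa [Prices.of] using congrArg Subtype.val h
  unfold firmProfit
  simp_rw [expectedPayoff_profit]
  calc (p : ℝ) * (1 - 2 * ε / (1 - p))
      = ∫ _, (p : ℝ) * (1 - 2 * ε / (1 - p)) ∂((ψ 0).prod (ψ 1)) := by simp
    _ ≤ _ := by
        refine integral_mono_ae (integrable_const _) (integrable_mul_sum_demand G ν σ i _) ?_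
        filter_upwards [hτ] with τ h
        have hle := le_demand_of_optimal G ν σ τ (hσ τ) i
        rw [h] at hle ⊢
        have hp' : 0 < 1 - (p : ℝ) := sub_pos.2 hp
        refine mul_le_mul_of_nonneg_left ?_ p.2.1
        rw [← mul_le_mul_iff_right₀ hp', mul_sub, mul_div_cancel₀ _ hp'.ne']
        linarith

/-! ### Sales in equilibrium under learning -/

instance (π : StrategyProfile S) {t : ℕ} (h : History t) (i : Fin 2) :
    IsProbabilityMeasure (π.pricesAt h i) := by
  unfold StrategyProfile.pricesAt
  infer_instance

instance (π : StrategyProfile S) {t : ℕ} (h : History t) : IsMarkovKernel (π.ruleAt h) := by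
  unfold StrategyProfile.ruleAt
  infer_instance

instance (μ₀ : ℝ) (G : SignalStructure S) (π : StrategyProfile S) (t : ℕ) :
    IsMarkovKernel (posterior μ₀ G π t) := by
  unfold posterior
  infer_instance

lemma periodKernel_real_action (G : SignalStructure S) (π : StrategyProfile S) (ω : State) (t : ℕ)
    (h : History t) (a : Action) :
    (periodKernel G π ω t h).real {y | y.2 = a} =
      ∫ τ, demand G (π.ruleAt h) a ω τ ∂((π.pricesAt h 0).prod (π.pricesAt h 1)) := by
  have hB : MeasurableSet {y : Period S | y.2 = a} := measurable_snd (measurableSet_singleton a)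
  have hm := measurable_real_singleton (π.ruleAt h) a
  have hint : Integrable (fun z => (π.ruleAt h z).real {a})
      (((π.pricesAt h 0).prod (π.pricesAt h 1)).prod (G.F ω)) := by
    refine .of_bound hm.aestronglyMeasurable 1 (ae_of_all _ fun z => ?_)
    rw [Real.norm_of_nonneg measureReal_nonneg]
    exact measureReal_le_one
  unfold demand
  rw [← integral_prod _ hint, measureReal_def, periodKernel, Kernel.compProd_apply hB,
    Kernel.prod_apply, Kernel.prod_apply, Kernel.const_apply]
  simp_rw [measureReal_def]
  rw [integral_toReal (Kernel.measurable_coe _ (measurableSet_singleton a)).aemeasurable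
    (ae_of_all _ fun z => measure_lt_top _ _)]
  rfl

/-- After almost every public history at which the belief in firm `i` is at least `1 - η ^ 2 / 8`,
firm `i` sells with probability at least `1 - η` in equilibrium. -/
lemma IsMyopicEquilibrium.le_lintegral_periodKernel {μ₀ : ℝ} {G : SignalStructure S}
    {π : StrategyProfile S} (hπ : IsMyopicEquilibrium μ₀ G π) (t : ℕ) (i : Fin 2) {η : ℝ}
    (hη : η ∈ Set.Ioo (0 : ℝ) 1) :
    ∀ᵐ h ∂((outcomeLaw μ₀ G π).map (history t)),
      1 - η ^ 2 / 8 ≤ (posterior μ₀ G π t h).real {i} →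
        ENNReal.ofReal (1 - η) ≤
          ∫⁻ ω, periodKernel G π ω t h {y | y.2 = some i} ∂(posterior μ₀ G π t h) := by
  filter_upwards [hπ t] with h ⟨hfirm, hcons⟩ hε
  -- With `ε = η ^ 2 / 8`, the deviation to the price `1 - η / 2` earns `(1 - η / 2) ^ 2 ≥ 1 - η`.
  let p : unitInterval := ⟨1 - η / 2, by linarith [hη.2], by linarith [hη.1]⟩
  have hp : (p : ℝ) = 1 - η / 2 := rfl
  have hdev := le_firmProfit_update G _ i (π.pricesAt h) (π.ruleAt h) hcons p
    (by linarith [hη.1]) hε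
  have hval : (p : ℝ) * (1 - 2 * (η ^ 2 / 8) / (1 - p)) = (1 - η / 2) ^ 2 := by
    have := hη.1.ne'
    rw [hp, sub_sub_cancel]
    field_simp
    ring
  have hsell := (hdev.trans (hfirm i p)).trans (firmProfit_le G _ i (π.pricesAt h) (π.ruleAt h))
  simp_rw [hval, ← periodKernel_real_action] at hsell
  refine ENNReal.ofReal_le_of_le_toReal ?_
  rw [lintegral_fintype, ENNReal.toReal_sum fun ω _ => by finiteness]
  simp_rw [ENNReal.toReal_mul, mul_comm (ENNReal.toReal (periodKernel _ _ _ _ _ _))]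
  refine le_trans ?_ hsell
  nlinarith [sq_nonneg η]

lemma isProbabilityMeasure_outcomeLaw {μ₀ : ℝ} (hμ₀ : μ₀ ∈ Set.Ioo (0 : ℝ) 1)
    (G : SignalStructure S) (π : StrategyProfile S) :
    IsProbabilityMeasure (outcomeLaw μ₀ G π) := by
  have : IsProbabilityMeasure (prior μ₀) := by
    refine ⟨?_⟩
    simp [prior, ← ENNReal.ofReal_add hμ₀.1.le (sub_nonneg.2 hμ₀.2.le)]
  unfold outcomeLaw
  infer_instance

lemma outcomeLaw_state_ne_zero {μ₀ : ℝ} (hμ₀ : μ₀ ∈ Set.Ioo (0 : ℝ) 1) (G : SignalStructure S)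
    (π : StrategyProfile S) (ω : State) : outcomeLaw μ₀ G π {x | state x = ω} ≠ 0 := by
  have h : outcomeLaw μ₀ G π {x | state x = ω} = prior μ₀ {ω} := by
    rw [← Measure.fst_compProd (prior μ₀) (Kernel.ofFunOfCountable (pathLaw G π)),
      Measure.fst_apply (measurableSet_singleton ω)]
    rfl
  rw [h]
  fin_cases ω
  · simp [prior, hμ₀.1]
  · simp [prior, hμ₀.2]

lemma measurableSet_le_posterior (μ₀ : ℝ) (G : SignalStructure S) (π : StrategyProfile S) (t : ℕ)
    (ω : State) (c : ℝ) : MeasurableSet {h | c ≤ (posterior μ₀ G π t h).real {ω}} :=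
  measurableSet_le measurable_const
    (Kernel.measurable_coe _ (measurableSet_singleton ω)).ennreal_toReal

/-- Learning makes the public belief in the realized state converge to `1` in probability. -/
lemma LearningHolds.tendsto_measure {μ₀ : ℝ} {G : SignalStructure S} {π : StrategyProfile S}
    (hlearn : LearningHolds μ₀ G π) (ω : State) {ε : ℝ} (hε : 0 < ε) :
    Tendsto (fun t => (outcomeLaw μ₀ G π).real
      {x | state x = ω ∧ (posterior μ₀ G π t (history t x)).real {ω} < 1 - ε}) atTop (𝓝 0) := by
  have hmeas (t : ℕ) : Measurable fun x : Outcome S =>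
      publicBelief μ₀ G π t (history t x) :=
    ((Kernel.measurable_coe (posterior μ₀ G π t)
      (measurableSet_singleton 0)).ennreal_toReal).comp (measurable_history t)
  have h := tendstoInMeasure_of_tendsto_ae (μ := outcomeLaw μ₀ G π)
    (fun t => (hmeas t).aestronglyMeasurable) hlearn
  rw [tendstoInMeasure_iff_measureReal_dist] at h
  refine squeeze_zero (fun _ => measureReal_nonneg) (fun t => ?_) (h ε hε)
  refine measureReal_mono ?_
  rintro x ⟨rfl, hx⟩
  have hsum := sum_real_singleton_state (posterior μ₀ G π t (history t x))
  rw [Fin.sum_univ_two] at hsum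
  simp only [Set.mem_ofPred_eq, publicBelief, Real.dist_eq]
  obtain hs | hs : state x = 0 ∨ state x = 1 := by
    generalize state x = s
    fin_cases s <;> simp
  · rw [hs] at hx ⊢
    rw [if_pos rfl, abs_sub_comm]
    exact le_trans (by linarith) (le_abs_self _)
  · rw [hs] at hx ⊢
    rw [if_neg one_ne_zero]
    exact le_trans (by linarith) (le_abs_self _)

/-- When the public belief in firm `i` is high, consumers rarely take an action other than buying
from firm `i`. -/
lemma IsMyopicEquilibrium.measureReal_le {μ₀ : ℝ} (hμ₀ : μ₀ ∈ Set.Ioo (0 : ℝ) 1)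
    {G : SignalStructure S} {π : StrategyProfile S} (hπ : IsMyopicEquilibrium μ₀ G π) (t : ℕ)
    (i : Fin 2) {η : ℝ} (hη : η ∈ Set.Ioo (0 : ℝ) 1) :
    (outcomeLaw μ₀ G π).real {x | 1 - η ^ 2 / 8 ≤ (posterior μ₀ G π t (history t x)).real {i} ∧
      action t x ≠ some i} ≤ η := by
  have := isProbabilityMeasure_outcomeLaw hμ₀ G π
  set A : Set (History t) := {h | 1 - η ^ 2 / 8 ≤ (posterior μ₀ G π t h).real {i}}
  have hA : MeasurableSet A := measurableSet_le_posterior μ₀ G π t i _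
  have hsell : ENNReal.ofReal (1 - η) * outcomeLaw μ₀ G π (history t ⁻¹' A) ≤
      outcomeLaw μ₀ G π {x | history t x ∈ A ∧ action t x = some i} := by
    rw [outcomeLaw_history_action μ₀ G π t hA, ← Measure.map_apply (by fun_prop) hA,
      ← setLIntegral_const]
    refine lintegral_mono_ae ((ae_restrict_iff' hA).2 ?_)
    exact hπ.le_lintegral_periodKernel t i hη
  have hsell' := ENNReal.toReal_mono (by finiteness) hsell
  rw [ENNReal.toReal_mul, ENNReal.toReal_ofReal (sub_nonneg.2 hη.2.le)] at hsell'
  have hsplit := measureReal_inter_add_sdiff (μ := outcomeLaw μ₀ G π) (s := history t ⁻¹' A)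
    (measurable_action t (measurableSet_singleton (some i)))
  change (1 - η) * (outcomeLaw μ₀ G π).real (history t ⁻¹' A) ≤
    (outcomeLaw μ₀ G π).real (history t ⁻¹' A ∩ action t ⁻¹' {some i}) at hsell'
  change (outcomeLaw μ₀ G π).real (history t ⁻¹' A \ action t ⁻¹' {some i}) ≤ η
  have hle : (outcomeLaw μ₀ G π).real (history t ⁻¹' A) ≤ 1 := measureReal_le_one
  nlinarith [hη.1]

lemma tendsto_measureReal_action_ne {μ₀ : ℝ} (hμ₀ : μ₀ ∈ Set.Ioo (0 : ℝ) 1)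
    {G : SignalStructure S} {π : StrategyProfile S} (hπ : IsMyopicEquilibrium μ₀ G π)
    (hlearn : LearningHolds μ₀ G π) (ω : State) :
    Tendsto (fun t => (outcomeLaw μ₀ G π).real {x | state x = ω ∧ action t x ≠ some ω})
      atTop (𝓝 0) := by
  rw [Metric.tendsto_nhds]
  intro c hc
  let η := min (c / 2) (1 / 2)
  have hη : η ∈ Set.Ioo (0 : ℝ) 1 :=
    ⟨lt_min (by positivity) (by norm_num), (min_le_right _ _).trans_lt (by norm_num)⟩
  have hηc : η ≤ c / 2 := min_le_left _ _
  have hsq : 0 < η ^ 2 / 8 := by have := hη.1; positivity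
  filter_upwards [(hlearn.tendsto_measure ω hsq).eventually_lt_const (half_pos hc)] with t ht
  rw [Real.dist_0_eq_abs, abs_of_nonneg measureReal_nonneg]
  calc (outcomeLaw μ₀ G π).real {x | state x = ω ∧ action t x ≠ some ω}
      ≤ (outcomeLaw μ₀ G π).real
          ({x | state x = ω ∧ (posterior μ₀ G π t (history t x)).real {ω} < 1 - η ^ 2 / 8} ∪
            {x | 1 - η ^ 2 / 8 ≤ (posterior μ₀ G π t (history t x)).real {ω} ∧
              action t x ≠ some ω}) := by
        refine measureReal_mono fun x hx => ?_
        rcases lt_or_ge ((posterior μ₀ G π t (history t x)).real {ω}) (1 - η ^ 2 / 8) with h | h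
        exacts [Or.inl ⟨hx.1, h⟩, Or.inr ⟨h, hx.2⟩]
    _ ≤ _ := measureReal_union_le _ _
    _ < c := by linarith [hπ.measureReal_le hμ₀ t ω hη]

end

end DuopolyLearning


theorem mainTheorem5 {S : Type*} [MeasurableSpace S] (G : DuopolyLearning.SignalStructure S)
    (μ₀ : ℝ) (hμ₀ : μ₀ ∈ Set.Ioo (0 : ℝ) 1) (π : DuopolyLearning.StrategyProfile S)
    (hπ : DuopolyLearning.IsMyopicEquilibrium μ₀ G π)
    (hlearn : DuopolyLearning.LearningHolds μ₀ G π) (ω : DuopolyLearning.State) :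
    Tendsto (fun t : ℕ =>
      (cond (DuopolyLearning.outcomeLaw μ₀ G π) {x | DuopolyLearning.state x = ω}).real
        {x | DuopolyLearning.action t x = some ω}) atTop (𝓝 1) := by
  open DuopolyLearning in
  have hms : MeasurableSet {x : Outcome S | state x = ω} :=
    measurable_state (measurableSet_singleton ω)
  have := cond_isProbabilityMeasure (outcomeLaw_state_ne_zero hμ₀ G π ω)
  have h := ((tendsto_measureReal_action_ne hμ₀ hπ hlearn ω).const_mul
    ((outcomeLaw μ₀ G π).real {x | state x = ω})⁻¹).const_sub 1
  rw [mul_zero, sub_zero] at h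
  refine h.congr fun t => ?_
  have hma : MeasurableSet {x : Outcome S | action t x = some ω} :=
    measurable_action t (measurableSet_singleton (some ω))
  rw [← compl_compl {x : Outcome S | action t x = some ω}, probReal_compl_eq_one_sub hma.compl,
    measureReal_def (cond _ _), cond_apply hms, ENNReal.toReal_mul, ENNReal.toReal_inv]
  rfl
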